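/- Let $\Omega\subset\mathbb{C}^n$ be a pseudoconvex domain, i.e. a domain admitting a plurisubharmonic function $\Phi$ with $\{\Phi<c\}\Subset\Omega$ for all $c\in\mathbb{R}$. Let $\{\Omega_j\}_{j}$ be a sequence of approximating subsets for $\Omega$, i.e. a sequence of open sets such that $\Omega_j\subset\Omega_{j+1}\Subset\Omega$ for all $j$, $\bigcup_j\Omega_j=\Omega$, and each $\Omega_j$ is a finite disjoint union of bounded, Levi pseudoconvex domains with smooth boundary. For an open set $U\subset\mathbb{C}^n$ and an integer $q\ge 0$, let $L^2_{0,q}(U)$ be the Hilbert space of $(0,q)$-forms $u=\sum'_{|I|=q}u_I\,d\bar z^I$ on $U$ with $\|u\|^2_{L^2_{0,q}(U)}=\sum'_{|I|=q}\int_U|u_I|^2\,dV<\infty$, where $\sum'$ is the sum over increasing multi-indices. Let $\bar\partial_q$ be the maximal $L^2$-extension of the Cauchy--Riemann operator on $(0,q)$-forms on $U$: it acts in the sense of distributions on the domain $\{u\in L^2_{0,q}(U):\bar\partial_q u\in L^2_{0,q+1}(U)\}$. Denote by $\mathscr{N}(\bar\partial_q)$ its null space. Fix $q\ge 0$. Suppose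 there is a constant $C>0$ such that for every $j$ and every $\alpha_j\in L^2_{0,q+1}(\Omega_j)\cap\mathscr{N}(\bar\partial_{q+1})$ there exists $v_j\in L^2_{0,q}(\Omega_j)\cap(\mathscr{N}(\bar\partial_q))^{\perp}$ with $\bar\partial_q v_j=\alpha_j$ on $\Omega_j$ in the sense of distributions and $$\|v_j\|_{L^2_{0,q}(\Omega_j)}\le C\,\|\alpha_j\|_{L^2_{0,q+1}(\Omega_j)}.$$ Then $\bar\partial_q$ has closed range on $\Omega$, i.e. the range of $\bar\partial_q$ on $\Omega$ is a closed subset of $L^2_{0,q+1}(\Omega)$. -/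

import Mathlib

open MeasureTheory Set
open scoped ContDiff ComplexConjugate

noncomputable section

namespace DbarClosedRange

/-- `ℂⁿ` with its Euclidean structure; `volume` is the Euclidean volume element. -/
abbrev Cn (n : ℕ) : Type := EuclideanSpace ℂ (Fin n)

/-- A domain: a nonempty connected open set. -/
def IsDomainSet {n : ℕ} (Ω : Set (Cn n)) : Prop := IsOpen Ω ∧ IsConnected Ω

/-- `U ⋐ V`: the closure of `U` is a compact subset of `V`. -/
def RelCompactIn {n : ℕ} (U V : Set (Cn n)) : Prop := IsCompact (closure U) ∧ closure U ⊆ V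

/-! ### Wirtinger derivatives -/

/-- `∂f/∂z_j = (1/2) (∂f/∂x_j - i ∂f/∂y_j)`. -/
def dz {n : ℕ} (j : Fin n) (f : Cn n → ℂ) (z : Cn n) : ℂ :=
  (1 / 2) * (fderiv ℝ f z (EuclideanSpace.single j 1)
    - Complex.I * fderiv ℝ f z (EuclideanSpace.single j Complex.I))

/-- `∂f/∂z̄_j = (1/2) (∂f/∂x_j + i ∂f/∂y_j)`. -/
def dzbar {n : ℕ} (j : Fin n) (f : Cn n → ℂ) (z : Cn n) : ℂ :=
  (1 / 2) * (fderiv ℝ f z (EuclideanSpace.single j 1)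
    + Complex.I * fderiv ℝ f z (EuclideanSpace.single j Complex.I))

/-! ### Pseudoconvexity -/

/-- Plurisubharmonic functions on `Ω` with values in `[-∞, ∞)`: upper semicontinuous, with the
sub-mean value property on every closed analytic disc `{z + ζ w : |ζ| ≤ 1} ⊆ Ω`. The mean over the
circle is the upper integral, i.e. the infimum of the means of the continuous majorants. -/
def IsPSH {n : ℕ} (Ω : Set (Cn n)) (Φ : Cn n → EReal) : Prop :=
  UpperSemicontinuousOn Φ Ω ∧ (∀ z ∈ Ω, Φ z ≠ ⊤) ∧
    ∀ z w : Cn n, (∀ ζ : ℂ, ‖ζ‖ ≤ 1 → z + ζ • w ∈ Ω) →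
      ∀ g : ℂ → ℝ, Continuous g → (∀ ζ : ℂ, ‖ζ‖ = 1 → Φ (z + ζ • w) ≤ (g ζ : EReal)) →
        Φ z ≤ ((Real.circleAverage g 0 1 : ℝ) : EReal)

/-- `Ω` admits a plurisubharmonic exhaustion function. -/
def IsPseudoconvex {n : ℕ} (Ω : Set (Cn n)) : Prop :=
  ∃ Φ : Cn n → EReal, IsPSH Ω Φ ∧ ∀ c : ℝ, RelCompactIn {z ∈ Ω | Φ z < (c : EReal)} Ω

/-- `r` is a smooth defining function for `Ω`. -/
def IsDefiningFunction {n : ℕ} (r : Cn n → ℝ) (Ω : Set (Cn n)) : Prop :=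
  ContDiff ℝ ∞ r ∧ Ω = {z | r z < 0} ∧ ∀ z, r z = 0 → fderiv ℝ r z ≠ 0

/-- The complex Hessian `i∂∂̄r(ξ, ξ)(p) = ∑_{k,l} ∂²r/∂z_l∂z̄_k (p) ξ_l conj(ξ_k)`. -/
def complexHessian {n : ℕ} (r : Cn n → ℝ) (p ξ : Cn n) : ℂ :=
  ∑ k : Fin n, ∑ l : Fin n,
    dz l (dzbar k (fun z => (r z : ℂ))) p * ξ l * conj (ξ k)

/-- `Ω` has smooth boundary and the Levi form of a defining function is nonnegative on the complex
tangent vectors at every boundary point. -/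
def IsSmoothLeviPseudoconvex {n : ℕ} (Ω : Set (Cn n)) : Prop :=
  ∃ r : Cn n → ℝ, IsDefiningFunction r Ω ∧
    ∀ p ∈ frontier Ω, ∀ ξ : Cn n,
      ∑ j : Fin n, dz j (fun z => (r z : ℂ)) p * ξ j = 0 → 0 ≤ (complexHessian r p ξ).re

/-- A sequence of approximating subsets for `Ω`. -/
structure IsApproximating {n : ℕ} (Ω : Set (Cn n)) (Ωs : ℕ → Set (Cn n)) : Prop where
  isOpen : ∀ j, IsOpen (Ωs j)
  mono : ∀ j, Ωs j ⊆ Ωs (j + 1)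
  relCompact : ∀ j, RelCompactIn (Ωs j) Ω
  iUnion_eq : ⋃ j, Ωs j = Ω
  components : ∀ j, ∃ (m : ℕ) (U : Fin m → Set (Cn n)),
    (∀ k, IsDomainSet (U k) ∧ Bornology.IsBounded (U k) ∧ IsSmoothLeviPseudoconvex (U k)) ∧
    Pairwise (fun k l => Disjoint (U k) (U l)) ∧ ⋃ k, U k = Ωs j

/-! ### `L²` forms and the operator `∂̄_q` -/

/-- Increasing multi-indices of length `q`, i.e. subsets of `{1, …, n}` with `q` elements. -/
abbrev MultiIndex (n q : ℕ) : Type := {I : Finset (Fin n) // I.card = q}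

/-- `L²_{0,q}(Ω)`: a form `∑' u_I dz̄^I` is given by its coefficients `(u_I)_{|I| = q}`, and the
inner product is `∑' ∫_Ω u_I conj(v_I) dV`. -/
abbrev L2Form (n q : ℕ) (Ω : Set (Cn n)) : Type :=
  Lp (EuclideanSpace ℂ (MultiIndex n q)) 2 ((volume : Measure (Cn n)).restrict Ω)

/-- The sign `ε` with `dz̄_j ∧ dz̄^I = ∑'_J ε(j, I, J) dz̄^J`: it vanishes unless `j ∉ I` and
`J = {j} ∪ I`, and is then the sign of the permutation that sorts `jI`. -/
def wedgeSign {n q : ℕ} (j : Fin n) (I : MultiIndex n q) (J : MultiIndex n (q + 1)) : ℂ :=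
  if j ∉ I.1 ∧ insert j I.1 = J.1 then (-1) ^ (I.1.filter (fun i => i < j)).card else 0

/-- Test functions on `Ω`: elements of `C_c^∞(Ω)`. -/
def IsTestFunction {n : ℕ} (Ω : Set (Cn n)) (φ : Cn n → ℂ) : Prop :=
  ContDiff ℝ ∞ φ ∧ HasCompactSupport φ ∧ tsupport φ ⊆ Ω

/-- `∂̄_q u = f` on `Ω` in the sense of distributions: for every `J`,
`∑_j ∑'_I ε(j, I, J) ∂u_I/∂z̄_j = f_J`, tested against `C_c^∞(Ω)`. -/
def WeakDbar {n : ℕ} (Ω : Set (Cn n)) (q : ℕ) (u : L2Form n q Ω) (f : L2Form n (q + 1) Ω) : Prop :=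
  ∀ φ : Cn n → ℂ, IsTestFunction Ω φ → ∀ J : MultiIndex n (q + 1),
    -(∑ j : Fin n, ∑ I : MultiIndex n q, wedgeSign j I J * ∫ z in Ω, u z I * dzbar j φ z)
      = ∫ z in Ω, f z J * φ z

lemma continuous_dzbar {n : ℕ} {Ω : Set (Cn n)} {φ : Cn n → ℂ} (hφ : IsTestFunction Ω φ)
    (j : Fin n) : Continuous (dzbar j φ) := by
  have h : Continuous (fderiv ℝ φ) := hφ.1.continuous_fderiv (by simp)
  unfold dzbar
  fun_prop

lemma hasCompactSupport_dzbar {n : ℕ} {Ω : Set (Cn n)} {φ : Cn n → ℂ} (hφ : IsTestFunction Ω φ)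
    (j : Fin n) : HasCompactSupport (dzbar j φ) := by
  refine (hφ.2.1.fderiv (𝕜 := ℝ)).mono fun z hz => ?_
  contrapose! hz
  have h0 : fderiv ℝ φ z = 0 := by simpa using hz
  simp [dzbar, h0]

lemma integrable_coeff_mul {n q : ℕ} {Ω : Set (Cn n)} (u : L2Form n q Ω) (I : MultiIndex n q)
    {ψ : Cn n → ℂ} (hc : Continuous ψ) (hs : HasCompactSupport ψ) :
    Integrable (fun z => u z I * ψ z) ((volume : Measure (Cn n)).restrict Ω) := by
  have h1 : MemLp (fun z => u z I) 2 ((volume : Measure (Cn n)).restrict Ω) :=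
    (Lp.memLp u).continuousLinearMap_comp
      (EuclideanSpace.proj I : EuclideanSpace ℂ (MultiIndex n q) →L[ℂ] ℂ)
  have h2 : MemLp ψ 2 ((volume : Measure (Cn n)).restrict Ω) :=
    (hc.memLp_of_hasCompactSupport hs).restrict Ω
  exact h1.integrable_mul h2

lemma integral_add_coeff {n q : ℕ} {Ω : Set (Cn n)} (u v : L2Form n q Ω) (I : MultiIndex n q)
    {ψ : Cn n → ℂ} (hc : Continuous ψ) (hs : HasCompactSupport ψ) :
    ∫ z in Ω, (u + v : L2Form n q Ω) z I * ψ z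
      = (∫ z in Ω, u z I * ψ z) + ∫ z in Ω, v z I * ψ z := by
  rw [← integral_add (integrable_coeff_mul u I hc hs) (integrable_coeff_mul v I hc hs)]
  refine integral_congr_ae ?_
  filter_upwards [Lp.coeFn_add u v] with z hz
  rw [hz, Pi.add_apply, PiLp.add_apply, add_mul]

lemma integral_smul_coeff {n q : ℕ} {Ω : Set (Cn n)} (c : ℂ) (u : L2Form n q Ω)
    (I : MultiIndex n q) (ψ : Cn n → ℂ) :
    ∫ z in Ω, (c • u : L2Form n q Ω) z I * ψ z = c * ∫ z in Ω, u z I * ψ z := by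
  rw [← integral_const_mul]
  refine integral_congr_ae ?_
  filter_upwards [Lp.coeFn_smul c u] with z hz
  rw [hz, Pi.smul_apply, PiLp.smul_apply, smul_eq_mul, mul_assoc]

lemma WeakDbar.add {n q : ℕ} {Ω : Set (Cn n)} {u v : L2Form n q Ω} {f g : L2Form n (q + 1) Ω}
    (hu : WeakDbar Ω q u f) (hv : WeakDbar Ω q v g) : WeakDbar Ω q (u + v) (f + g) := by
  intro φ hφ J
  rw [integral_add_coeff f g J hφ.1.continuous hφ.2.1, ← hu φ hφ J, ← hv φ hφ J,
    ← neg_add, ← Finset.sum_add_distrib]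
  congr 1
  refine Finset.sum_congr rfl fun j _ => ?_
  rw [← Finset.sum_add_distrib]
  refine Finset.sum_congr rfl fun I _ => ?_
  rw [integral_add_coeff u v I (continuous_dzbar hφ j) (hasCompactSupport_dzbar hφ j), mul_add]

lemma WeakDbar.smul {n q : ℕ} {Ω : Set (Cn n)} {u : L2Form n q Ω} {f : L2Form n (q + 1) Ω}
    (c : ℂ) (hu : WeakDbar Ω q u f) : WeakDbar Ω q (c • u) (c • f) := by
  intro φ hφ J
  rw [integral_smul_coeff c f J φ, ← hu φ hφ J, mul_neg, Finset.mul_sum]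
  congr 1
  refine Finset.sum_congr rfl fun j _ => ?_
  rw [Finset.mul_sum]
  refine Finset.sum_congr rfl fun I _ => ?_
  rw [integral_smul_coeff]
  ring

lemma WeakDbar.zero {n q : ℕ} {Ω : Set (Cn n)} :
    WeakDbar Ω q (0 : L2Form n q Ω) (0 : L2Form n (q + 1) Ω) := by
  intro φ hφ J
  have h := integral_smul_coeff (0 : ℂ) (0 : L2Form n (q + 1) Ω) J φ
  have h' : ∀ (j : Fin n) (I : MultiIndex n q),
      ∫ z in Ω, (0 : L2Form n q Ω) z I * dzbar j φ z = 0 := fun j I => by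
    have h0 := integral_smul_coeff (0 : ℂ) (0 : L2Form n q Ω) I (dzbar j φ)
    rwa [zero_smul, zero_mul] at h0
  rw [zero_smul, zero_mul] at h
  rw [h]
  simp only [h', mul_zero, Finset.sum_const_zero, neg_zero]

/-- The graph of the maximal `L²` extension of `∂̄_q`:
the pairs `(u, ∂̄_q u)` with `u ∈ L²_{0,q}(Ω)` and `∂̄_q u ∈ L²_{0,q+1}(Ω)`. -/
def dbarGraph {n : ℕ} (Ω : Set (Cn n)) (q : ℕ) :
    Submodule ℂ (L2Form n q Ω × L2Form n (q + 1) Ω) where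
  carrier := {p | WeakDbar Ω q p.1 p.2}
  add_mem' hp hp' := WeakDbar.add hp hp'
  zero_mem' := WeakDbar.zero
  smul_mem' c _ hp := WeakDbar.smul c hp

/-- The null space `N(∂̄_q) ⊆ L²_{0,q}(Ω)`. -/
def dbarKer {n : ℕ} (Ω : Set (Cn n)) (q : ℕ) : Submodule ℂ (L2Form n q Ω) :=
  (dbarGraph Ω q).comap (LinearMap.inl ℂ (L2Form n q Ω) (L2Form n (q + 1) Ω))

/-- The range `R(∂̄_q) ⊆ L²_{0,q+1}(Ω)`. -/
def dbarRange {n : ℕ} (Ω : Set (Cn n)) (q : ℕ) : Submodule ℂ (L2Form n (q + 1) Ω) :=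
  (dbarGraph Ω q).map (LinearMap.snd ℂ (L2Form n q Ω) (L2Form n (q + 1) Ω))

end DbarClosedRange

end

open DbarClosedRange

namespace DbarClosedRange

/-! The uniform bound on the exhausting sets gives more than closedness: on `Ω` the range of `∂̄_q`
equals the null space of `∂̄_{q+1}` (`dbarRange_eq_dbarKer_of_uniform_bound`), and a null space is
closed because it is cut out by continuous functionals (`isClosed_dbarKer`).

The range lies in the null space because `∂̄ ∘ ∂̄ = 0` (`WeakDbar.mem_dbarKer`). Conversely, given
`f` with `∂̄f = 0`, solve `∂̄v_j = f` on each `Ω_j`. The extensions of the `v_j` by zero are bounded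
by `C‖f‖` in `L²(Ω)`, hence have a weak cluster point `u`. A fixed test function is supported in
`Ω_j` for all large `j`, so each tested equation holds eventually along the sequence and passes to
`u`. -/

/-! ### Weak limits -/

/-- A bounded sequence in a Hilbert space has a weak cluster point, at which every continuous
functional that is eventually constant along the sequence takes the same value. -/
lemma exists_forall_functional_eq_of_bounded {H : Type*} [NormedAddCommGroup H]
    [InnerProductSpace ℂ H] [CompleteSpace H] (x : ℕ → H) (R : ℝ) (hx : ∀ j, ‖x j‖ ≤ R) :
    ∃ y : H, ∀ (ℓ : H →L[ℂ] ℂ) (c : ℂ), (∀ᶠ j in Filter.atTop, ℓ (x j) = c) → ℓ y = c := by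
  let F : ℕ → WeakDual ℂ H := fun j =>
    StrongDual.toWeakDual (InnerProductSpace.toDual ℂ H (x j))
  have hK : IsCompact (WeakDual.toStrongDual ⁻¹' Metric.closedBall (0 : StrongDual ℂ H) R) :=
    WeakDual.isCompact_closedBall 0 R
  have hF : ∀ j, F j ∈ WeakDual.toStrongDual ⁻¹' Metric.closedBall (0 : StrongDual ℂ H) R := by
    intro j
    have h : ‖InnerProductSpace.toDual ℂ H (x j)‖ ≤ R := by
      rw [LinearIsometryEquiv.norm_map]
      exact hx j
    simpa [F] using h
  -- Banach–Alaoglu: a cluster point is enough, so no weakly convergent subsequence is extracted.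
  obtain ⟨G, -, hG⟩ := hK.exists_mapClusterPt_of_frequently (l := Filter.atTop) (f := F)
    (Filter.Frequently.of_forall hF)
  refine ⟨(InnerProductSpace.toDual ℂ H).symm (WeakDual.toStrongDual G), fun ℓ c hc => ?_⟩
  obtain ⟨w, rfl⟩ := (InnerProductSpace.toDual ℂ H).surjective ℓ
  have hw : MapClusterPt (G w) Filter.atTop (fun j => F j w) :=
    hG.continuousAt_comp (WeakDual.eval_continuous w).continuousAt
  -- The conjugate appears because `F j w` is `⟪x j, w⟫`, whereas the functional represented by `w`
  -- sends `x j` to `⟪w, x j⟫`.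
  have hc' : Filter.Tendsto (fun j => F j w) Filter.atTop (nhds (conj c)) := by
    refine tendsto_const_nhds.congr' ?_
    filter_upwards [hc] with j hj
    rw [← hj]
    simp [F]
  have hGw : G w = conj c := by
    by_contra hne
    have := hw.clusterPt
    exact (this.mono hc').neBot.ne (disjoint_iff.mp (disjoint_nhds_nhds.mpr hne))
  have h2 : inner ℂ ((InnerProductSpace.toDual ℂ H).symm (WeakDual.toStrongDual G)) w = conj c := by
    rw [InnerProductSpace.toDual_symm_apply]
    exact hGw
  rw [InnerProductSpace.toDual_apply_apply, ← inner_conj_symm, h2, Complex.conj_conj]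

/-! ### The weak equation through continuous functionals -/

/-- The integral is the inner product with the `L²` form `conj ψ dz̄^I`, hence continuous in `u`. -/
lemma exists_integral_functional {n q : ℕ} (Ω : Set (Cn n)) (I : MultiIndex n q)
    {ψ : Cn n → ℂ} (hc : Continuous ψ) (hs : HasCompactSupport ψ) :
    ∃ ℓ : L2Form n q Ω →L[ℂ] ℂ, ∀ u, ℓ u = ∫ z in Ω, u z I * ψ z := by
  have hm : MemLp (fun z => EuclideanSpace.single I (conj (ψ z)) :
      Cn n → EuclideanSpace ℂ (MultiIndex n q)) 2 ((volume : Measure (Cn n)).restrict Ω) := by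
    have h2 : MemLp ψ 2 ((volume : Measure (Cn n)).restrict Ω) :=
      (hc.memLp_of_hasCompactSupport hs).restrict Ω
    refine h2.of_le (g := ψ) ?_ (Filter.Eventually.of_forall fun z => ?_)
    · refine Continuous.aestronglyMeasurable ?_
      have : Continuous fun a : ℂ =>
          (EuclideanSpace.single I a : EuclideanSpace ℂ (MultiIndex n q)) := by
        refine (PiLp.continuous_toLp 2 _).comp ?_
        exact continuous_single (A := fun _ : MultiIndex n q => ℂ) I
      exact this.comp (Complex.continuous_conj.comp hc)
    · simp
  refine ⟨innerSL ℂ (hm.toLp _), fun u => ?_⟩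
  rw [innerSL_apply_apply, L2.inner_def]
  refine integral_congr_ae ?_
  filter_upwards [hm.coeFn_toLp] with z hz
  rw [hz, EuclideanSpace.inner_single_left, Complex.conj_conj, mul_comm]

lemma exists_dbar_functional {n q : ℕ} {Ω : Set (Cn n)} {φ : Cn n → ℂ}
    (hφ : IsTestFunction Ω φ) (J : MultiIndex n (q + 1)) :
    ∃ ℓ : L2Form n q Ω →L[ℂ] ℂ, ∀ u, ℓ u =
      -(∑ j : Fin n, ∑ I : MultiIndex n q,
        wedgeSign j I J * ∫ z in Ω, u z I * dzbar j φ z) := by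
  choose ℓ hℓ using fun (j : Fin n) (I : MultiIndex n q) =>
    exists_integral_functional Ω I (continuous_dzbar hφ j) (hasCompactSupport_dzbar hφ j)
  refine ⟨-(∑ j : Fin n, ∑ I : MultiIndex n q, wedgeSign j I J • ℓ j I), fun u => ?_⟩
  simp [hℓ]

lemma integral_zero_coeff {n q : ℕ} {Ω : Set (Cn n)} (J : MultiIndex n q) (ψ : Cn n → ℂ) :
    ∫ z in Ω, (0 : L2Form n q Ω) z J * ψ z = 0 := by
  simpa using integral_smul_coeff (0 : ℂ) (0 : L2Form n q Ω) J ψ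

lemma mem_dbarKer_iff {n q : ℕ} {Ω : Set (Cn n)} {u : L2Form n q Ω} :
    u ∈ dbarKer Ω q ↔ ∀ φ : Cn n → ℂ, IsTestFunction Ω φ → ∀ J : MultiIndex n (q + 1),
      -(∑ j : Fin n, ∑ I : MultiIndex n q, wedgeSign j I J * ∫ z in Ω, u z I * dzbar j φ z)
        = 0 := by
  have h : u ∈ dbarKer Ω q ↔ WeakDbar Ω q u 0 := Iff.rfl
  simp only [h, WeakDbar, integral_zero_coeff]

lemma isClosed_dbarKer {n : ℕ} (Ω : Set (Cn n)) (q : ℕ) :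
    IsClosed (dbarKer Ω q : Set (L2Form n q Ω)) := by
  have h : (dbarKer Ω q : Set (L2Form n q Ω)) =
      {u | ∀ φ : Cn n → ℂ, IsTestFunction Ω φ → ∀ J : MultiIndex n (q + 1),
        -(∑ j : Fin n, ∑ I : MultiIndex n q, wedgeSign j I J * ∫ z in Ω, u z I * dzbar j φ z)
          = 0} := Set.ext fun u => mem_dbarKer_iff
  rw [h]
  simp only [Set.ofPred_forall]
  refine isClosed_iInter fun φ => isClosed_iInter fun hφ => isClosed_iInter fun J => ?_
  obtain ⟨ℓ, hℓ⟩ := exists_dbar_functional (q := q) hφ J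
  simp only [← hℓ]
  exact isClosed_eq ℓ.continuous continuous_const

/-! ### `∂̄ ∘ ∂̄ = 0` -/

lemma contDiff_dzbar {n : ℕ} {φ : Cn n → ℂ} (hφ : ContDiff ℝ ∞ φ) (j : Fin n) :
    ContDiff ℝ ∞ (dzbar j φ) := by
  have h : ContDiff ℝ ∞ (fderiv ℝ φ) := hφ.fderiv_right (by simp)
  unfold dzbar
  fun_prop

lemma IsTestFunction.dzbar {n : ℕ} {Ω : Set (Cn n)} {φ : Cn n → ℂ} (hφ : IsTestFunction Ω φ)
    (j : Fin n) : IsTestFunction Ω (dzbar j φ) := by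
  refine ⟨contDiff_dzbar hφ.1 j, hasCompactSupport_dzbar hφ j, ?_⟩
  refine (closure_minimal ?_ (isClosed_tsupport φ)).trans hφ.2.2
  intro z hz
  refine support_fderiv_subset ℝ fun h0 => hz ?_
  simp [DbarClosedRange.dzbar, h0]

lemma dzbar_comm {n : ℕ} {φ : Cn n → ℂ} (hφ : ContDiff ℝ ∞ φ) (j k : Fin n) :
    dzbar k (dzbar j φ) = dzbar j (dzbar k φ) := by
  funext z
  have hd : DifferentiableAt ℝ (fderiv ℝ φ) z :=
    ((hφ.fderiv_right (m := ∞) (by simp)).differentiable (by simp)) z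
  have hsymm : IsSymmSndFDerivAt ℝ φ z :=
    hφ.contDiffAt.isSymmSndFDerivAt (by
      simpa using WithTop.coe_le_coe.mpr (le_top : (2 : ℕ∞) ≤ ⊤))
  have key : ∀ (i : Fin n) (v : Cn n), fderiv ℝ (dzbar i φ) z v =
      (1 / 2) * (fderiv ℝ (fderiv ℝ φ) z v (EuclideanSpace.single i 1)
        + Complex.I * fderiv ℝ (fderiv ℝ φ) z v (EuclideanSpace.single i Complex.I)) := by
    intro i v
    have h1 : ∀ w : Cn n, HasFDerivAt (fun y => fderiv ℝ φ y w)
        ((fderiv ℝ (fderiv ℝ φ) z).flip w) z := fun w => by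
      simpa using hd.hasFDerivAt.clm_apply (hasFDerivAt_const w z)
    have h2 := ((h1 (EuclideanSpace.single i 1)).add
      ((h1 (EuclideanSpace.single i Complex.I)).const_mul Complex.I)).const_mul (1 / 2 : ℂ)
    have h3 : fderiv ℝ (dzbar i φ) z = _ := h2.fderiv
    rw [h3]
    simp [mul_add]
  simp only [dzbar.eq_def k (dzbar j φ), dzbar.eq_def j (dzbar k φ), key]
  rw [hsymm.eq (EuclideanSpace.single k 1) (EuclideanSpace.single j 1),
    hsymm.eq (EuclideanSpace.single k 1) (EuclideanSpace.single j Complex.I),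
    hsymm.eq (EuclideanSpace.single k Complex.I) (EuclideanSpace.single j 1),
    hsymm.eq (EuclideanSpace.single k Complex.I) (EuclideanSpace.single j Complex.I)]
  ring

/-- This is the coefficient of `dz̄^K` in `dz̄_j ∧ dz̄_k ∧ dz̄^I`. Only `J = {k} ∪ I` contributes;
moving `dz̄_j` into place passes `dz̄_k` exactly when `k < j`, which costs the extra sign. -/
lemma sum_wedgeSign_mul {n q : ℕ} (j k : Fin n) (I : MultiIndex n q)
    (K : MultiIndex n (q + 1 + 1)) :
    ∑ J : MultiIndex n (q + 1), wedgeSign j J K * wedgeSign k I J =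
      if k ∉ I.1 ∧ j ∉ I.1 ∧ j ≠ k ∧ insert j (insert k I.1) = K.1 then
        (-1) ^ ((I.1.filter (fun i => i < j)).card + (I.1.filter (fun i => i < k)).card)
          * (if k < j then -1 else 1) else 0 := by
  by_cases hk : k ∈ I.1
  · simp [wedgeSign, hk]
  have hcard : (insert k I.1).card = q + 1 := by rw [Finset.card_insert_of_notMem hk, I.2]
  rw [Finset.sum_eq_single (⟨insert k I.1, hcard⟩ : MultiIndex n (q + 1))]
  · by_cases hjk : j = k
    · simp [wedgeSign, hjk]
    by_cases hj : j ∈ I.1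
    · simp [wedgeSign, hj]
    by_cases hK : insert j (insert k I.1) = K.1
    · by_cases hlt : k < j
      · have : k ∉ I.1.filter (fun i => i < j) := by simp [hk]
        simp [wedgeSign, hj, hk, hjk, hK, hlt, Finset.filter_insert, this, pow_succ, pow_add]
      · simp [wedgeSign, hj, hk, hjk, hK, hlt, Finset.filter_insert, pow_add]
    · simp [wedgeSign, hK]
  · intro J _ hJ
    have : insert k I.1 ≠ J.1 := fun h => hJ (Subtype.ext h.symm)
    simp [wedgeSign, this]
  · simp

lemma sum_wedgeSign_mul_antisymm {n q : ℕ} (j k : Fin n) (I : MultiIndex n q)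
    (K : MultiIndex n (q + 1 + 1)) :
    ∑ J : MultiIndex n (q + 1), wedgeSign j J K * wedgeSign k I J =
      -∑ J : MultiIndex n (q + 1), wedgeSign k J K * wedgeSign j I J := by
  rw [sum_wedgeSign_mul, sum_wedgeSign_mul, Finset.insert_comm k j]
  by_cases h : k ∉ I.1 ∧ j ∉ I.1 ∧ j ≠ k ∧ insert j (insert k I.1) = K.1
  · have h' : j ∉ I.1 ∧ k ∉ I.1 ∧ k ≠ j ∧ insert j (insert k I.1) = K.1 :=
      ⟨h.2.1, h.1, h.2.2.1.symm, h.2.2.2⟩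
    rw [if_pos h, if_pos h', add_comm]
    rcases lt_or_gt_of_ne h.2.2.1 with hlt | hlt
    · simp [hlt, hlt.not_gt]
    · simp [hlt, hlt.not_gt]
  · have h' : ¬(j ∉ I.1 ∧ k ∉ I.1 ∧ k ≠ j ∧ insert j (insert k I.1) = K.1) :=
      fun h' => h ⟨h'.2.1, h'.1, h'.2.2.1.symm, h'.2.2.2⟩
    rw [if_neg h, if_neg h', neg_zero]

/-- Since `∂φ/∂z̄_j` is again a test function, the equation for `u` may be tested against it. What
results is a sum over `j, k` of antisymmetric wedge signs times symmetric second derivatives, which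
vanishes. -/
lemma WeakDbar.mem_dbarKer {n q : ℕ} {Ω : Set (Cn n)} {u : L2Form n q Ω}
    {f : L2Form n (q + 1) Ω} (h : WeakDbar Ω q u f) : f ∈ dbarKer Ω (q + 1) := by
  rw [mem_dbarKer_iff]
  intro φ hφ K
  set T : Fin n → Fin n → MultiIndex n q → ℂ :=
    fun j k I => ∫ z in Ω, u z I * DbarClosedRange.dzbar k (DbarClosedRange.dzbar j φ) z with hT
  have hTsymm : ∀ j k I, T j k I = T k j I := fun j k I => by
    simp only [hT, dzbar_comm hφ.1 j k]
  have hsum : ∑ j : Fin n, ∑ J : MultiIndex n (q + 1),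
      wedgeSign j J K * ∫ z in Ω, f z J * DbarClosedRange.dzbar j φ z =
      -∑ j : Fin n, ∑ k : Fin n, ∑ I : MultiIndex n q,
        (∑ J : MultiIndex n (q + 1), wedgeSign j J K * wedgeSign k I J) * T j k I := by
    rw [← Finset.sum_neg_distrib]
    refine Finset.sum_congr rfl fun j _ => ?_
    simp only [← h _ (hφ.dzbar j), mul_neg, Finset.sum_neg_distrib, Finset.mul_sum,
      Finset.sum_mul, mul_assoc]
    rw [Finset.sum_comm]
    congr 1
    refine Finset.sum_congr rfl fun k _ => ?_
    rw [Finset.sum_comm]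
  rw [hsum, neg_neg]
  set S := ∑ j : Fin n, ∑ k : Fin n, ∑ I : MultiIndex n q,
    (∑ J : MultiIndex n (q + 1), wedgeSign j J K * wedgeSign k I J) * T j k I with hS
  have hneg : S = -S := by
    -- Exchanging the roles of `j` and `k` keeps `T` and flips the sign of the coefficient.
    conv_lhs => rw [hS, Finset.sum_comm]
    rw [hS, ← Finset.sum_neg_distrib]
    refine Finset.sum_congr rfl fun j _ => ?_
    rw [← Finset.sum_neg_distrib]
    refine Finset.sum_congr rfl fun k _ => ?_
    rw [← Finset.sum_neg_distrib]
    refine Finset.sum_congr rfl fun I _ => ?_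
    rw [sum_wedgeSign_mul_antisymm k j, hTsymm k j, neg_mul]
  exact self_eq_neg.mp hneg

/-! ### Restriction and extension by zero -/

lemma IsTestFunction.mono {n : ℕ} {U V : Set (Cn n)} {φ : Cn n → ℂ} (hφ : IsTestFunction U φ)
    (h : U ⊆ V) : IsTestFunction V φ := ⟨hφ.1, hφ.2.1, hφ.2.2.trans h⟩

lemma setIntegral_mul_eq_of_tsupport_subset {n : ℕ} {U V : Set (Cn n)} (h : U ⊆ V)
    {g ψ : Cn n → ℂ} (hψ : tsupport ψ ⊆ U) :
    ∫ z in U, g z * ψ z = ∫ z in V, g z * ψ z := by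
  have h0 : ∀ z ∉ U, g z * ψ z = 0 := fun z hz => by
    rw [image_eq_zero_of_notMem_tsupport fun hz' => hz (hψ hz'), mul_zero]
  rw [setIntegral_eq_integral_of_forall_compl_eq_zero h0,
    setIntegral_eq_integral_of_forall_compl_eq_zero fun z hz => h0 z fun hz' => hz (h hz')]

/-- The restriction of a form to a smaller set. -/
noncomputable def restrictForm {n q : ℕ} {U V : Set (Cn n)} (h : U ⊆ V) (f : L2Form n q V) : L2Form n q U :=
  ((Lp.memLp f).mono_measure (Measure.restrict_mono_set volume h)).toLp f

lemma norm_restrictForm_le {n q : ℕ} {U V : Set (Cn n)} (h : U ⊆ V) (f : L2Form n q V) :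
    ‖restrictForm h f‖ ≤ ‖f‖ := by
  rw [restrictForm, Lp.norm_toLp, Lp.norm_def]
  exact ENNReal.toReal_mono (Lp.eLpNorm_ne_top f)
    (eLpNorm_mono_measure _ (Measure.restrict_mono_set volume h))

lemma integral_restrictForm {n q : ℕ} {U V : Set (Cn n)} (h : U ⊆ V)
    (f : L2Form n q V) (I : MultiIndex n q) {ψ : Cn n → ℂ} (hψ : tsupport ψ ⊆ U) :
    ∫ z in U, restrictForm h f z I * ψ z = ∫ z in V, f z I * ψ z := by
  rw [← setIntegral_mul_eq_of_tsupport_subset h hψ]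
  refine integral_congr_ae ?_
  filter_upwards [((Lp.memLp f).mono_measure
    (Measure.restrict_mono_set volume h)).coeFn_toLp] with z hz
  rw [restrictForm, hz]

lemma restrictForm_mem_dbarKer {n q : ℕ} {U V : Set (Cn n)} (h : U ⊆ V)
    {f : L2Form n q V} (hf : f ∈ dbarKer V q) : restrictForm h f ∈ dbarKer U q := by
  rw [mem_dbarKer_iff] at hf ⊢
  intro φ hφ J
  rw [← hf φ (hφ.mono h) J]
  simp only [integral_restrictForm h f _ (hφ.dzbar _).2.2]

lemma memLp_indicator_form {n q : ℕ} {U : Set (Cn n)} (hU : MeasurableSet U) (V : Set (Cn n))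
    (v : L2Form n q U) :
    MemLp (U.indicator v) 2 ((volume : Measure (Cn n)).restrict V) :=
  ((memLp_indicator_iff_restrict hU).mpr (Lp.memLp v)).restrict V

/-- The extension of a form by zero. -/
noncomputable def extendForm {n q : ℕ} {U : Set (Cn n)} (hU : MeasurableSet U) (V : Set (Cn n))
    (v : L2Form n q U) : L2Form n q V :=
  (memLp_indicator_form hU V v).toLp _

lemma norm_extendForm_le {n q : ℕ} {U : Set (Cn n)} (hU : MeasurableSet U) (V : Set (Cn n))
    (v : L2Form n q U) : ‖extendForm hU V v‖ ≤ ‖v‖ := by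
  rw [extendForm, Lp.norm_toLp, Lp.norm_def]
  refine ENNReal.toReal_mono (Lp.eLpNorm_ne_top v) ?_
  rw [← eLpNorm_indicator_eq_eLpNorm_restrict hU]
  exact eLpNorm_mono_measure _ Measure.restrict_le_self

/-- Extension by zero need not preserve the equation across the boundary of `U`; it does so against
test functions supported in `U`, which is all that the limit requires. -/
lemma integral_extendForm {n q : ℕ} {U V : Set (Cn n)} (hU : MeasurableSet U) (h : U ⊆ V)
    (v : L2Form n q U) (I : MultiIndex n q) {ψ : Cn n → ℂ} (hψ : tsupport ψ ⊆ U) :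
    ∫ z in V, extendForm hU V v z I * ψ z = ∫ z in U, v z I * ψ z := by
  have h1 : ∫ z in V, extendForm hU V v z I * ψ z = ∫ z in V, U.indicator v z I * ψ z := by
    refine integral_congr_ae ?_
    filter_upwards [(memLp_indicator_form hU V v).coeFn_toLp] with z hz
    rw [extendForm, hz]
  rw [h1, ← setIntegral_mul_eq_of_tsupport_subset h hψ]
  refine setIntegral_congr_fun hU fun z hz => ?_
  simp only [Set.indicator_of_mem hz]

/-! ### Solving on the union -/

lemma IsTestFunction.exists_subset {n : ℕ} {Ω : Set (Cn n)} {Ωs : ℕ → Set (Cn n)}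
    (happrox : IsApproximating Ω Ωs) {φ : Cn n → ℂ} (hφ : IsTestFunction Ω φ) :
    ∃ N, ∀ j, N ≤ j → IsTestFunction (Ωs j) φ := by
  have hmono : Monotone Ωs := monotone_nat_of_le_succ happrox.mono
  have hcov : tsupport φ ⊆ ⋃ j, Ωs j := happrox.iUnion_eq ▸ hφ.2.2
  obtain ⟨N, hN⟩ := hφ.2.1.isCompact.elim_directed_cover Ωs happrox.isOpen hcov
    hmono.directed_le
  exact ⟨N, fun j hj => ⟨hφ.1, hφ.2.1, hN.trans (hmono hj)⟩⟩

lemma dbarRange_eq_dbarKer_of_uniform_bound {n q : ℕ} {Ω : Set (Cn n)} {Ωs : ℕ → Set (Cn n)}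
    (happrox : IsApproximating Ω Ωs) (C : ℝ) (hC : 0 ≤ C)
    (hsolve : ∀ (j : ℕ) (α : L2Form n (q + 1) (Ωs j)), α ∈ dbarKer (Ωs j) (q + 1) →
      ∃ v : L2Form n q (Ωs j), WeakDbar (Ωs j) q v α ∧ ‖v‖ ≤ C * ‖α‖) :
    dbarRange Ω q = dbarKer Ω (q + 1) := by
  refine le_antisymm ?_ fun f hf => ?_
  · rintro _ ⟨⟨u, f⟩, huf, rfl⟩
    exact WeakDbar.mem_dbarKer huf
  have hsub : ∀ j, Ωs j ⊆ Ω := fun j => happrox.iUnion_eq ▸ Set.subset_iUnion Ωs j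
  have hmeas : ∀ j, MeasurableSet (Ωs j) := fun j => (happrox.isOpen j).measurableSet
  choose v hv hvn using fun j =>
    hsolve j (restrictForm (hsub j) f) (restrictForm_mem_dbarKer (hsub j) hf)
  obtain ⟨u, hu⟩ := exists_forall_functional_eq_of_bounded
    (fun j => extendForm (hmeas j) Ω (v j)) (C * ‖f‖) fun j =>
      ((norm_extendForm_le _ _ _).trans (hvn j)).trans
        (mul_le_mul_of_nonneg_left (norm_restrictForm_le (hsub j) f) hC)
  refine ⟨(u, f), fun φ hφ J => ?_, rfl⟩
  obtain ⟨ℓ, hℓ⟩ := exists_dbar_functional (q := q) hφ J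
  rw [← hℓ]
  -- It remains to see that `ℓ` takes the value `∫ f_J φ` on all late terms. Compactness of the
  -- support of `φ` and monotonicity of the `Ω_j` supply the threshold `N`.
  refine hu ℓ _ ?_
  obtain ⟨N, hN⟩ := hφ.exists_subset happrox
  filter_upwards [Filter.eventually_ge_atTop N] with j hj
  have hφj := hN j hj
  have := hv j φ hφj J
  rw [integral_restrictForm (hsub j) f J hφj.2.2] at this
  rw [hℓ, ← this]
  simp only [integral_extendForm (hmeas j) (hsub j) (v j) _ (hφj.dzbar _).2.2]

end DbarClosedRange

theorem lemmaL (n q : ℕ) (Ω : Set (Cn n)) (hΩ : IsDomainSet Ω) (hpsc : IsPseudoconvex Ω)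
    (Ωs : ℕ → Set (Cn n)) (happrox : IsApproximating Ω Ωs)
    (C : ℝ) (hC : 0 < C)
    (hsolve : ∀ (j : ℕ) (α : L2Form n (q + 1) (Ωs j)), α ∈ dbarKer (Ωs j) (q + 1) →
      ∃ v : L2Form n q (Ωs j), v ∈ (dbarKer (Ωs j) q)ᗮ ∧
        WeakDbar (Ωs j) q v α ∧ ‖v‖ ≤ C * ‖α‖) :
    IsClosed (dbarRange Ω q : Set (L2Form n (q + 1) Ω)) := by
  have hker := dbarRange_eq_dbarKer_of_uniform_bound happrox C hC.le fun j α hα =>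
    (hsolve j α hα).imp fun _ h => h.2
  rw [hker]
  exact isClosed_dbarKer Ω (q + 1)
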